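/- Let $n\ge 1$ and let $X\subseteq\mathbb{R}^n$ be a nonempty set. For $r>0$ let $e_r(X)=X\setminus\bigcup_{y\notin X}B(r,y)$ be the erosion of $X$ by $r$, where $B(r,y)$ is the open ball of radius $r$ about $y$. A closed half-space $H\supseteq X$ is a supporting half-space of $X$ at a boundary point $x$ of $X$ if $x$ also lies on the boundary of $H$. A boundary point of $X$ is regular if there is exactly one supporting half-space of $X$ at it, and a supporting half-space is regular if it is supporting at some regular point. A regular supporting hyperplane is the boundary of a regular supporting half-space $H$; it is oriented by the unit normal pointing into $H$. The dihedral angle of two oriented hyperplanes is the angle in $[0,\pi]$ between their orienting normals. **Theorem.** The following are equivalent. 1. $e_r(X)=\sigma(X)$ for some $r>0$ and some isometry $\sigma$ of $\mathbb{R}^n$. 2. $X$ is closed and convex, has nonempty interior, and there are an oriented hyperplane $K$ and an angle $\theta\neq\frac{\pi}{2}$ such that every regular supporting hyperplane of $X$ makes the dihedral angle $\theta$ with $K$. In particular, a closed convex set $X$ with nonempty interior satisfies (1) if and only if all its regular supporting hyperplanes make a common dihedral angle $\neq\frac{\pi}{2}$ with some fixed oriented hyperplane; and every nonempty set satisfying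 (1) is automatically closed and convex with nonempty interior. -/

import Mathlib

namespace Resilient

/-- The erosion `e_r(X)`: the set `X` minus all open balls of radius `r` centred in its
complement. -/
def erosion {n : ℕ} (r : ℝ) (X : Set (EuclideanSpace ℝ (Fin n))) :
    Set (EuclideanSpace ℝ (Fin n)) :=
  X \ ⋃ y ∈ Xᶜ, Metric.ball y r

/-- The unit vector `ν` is the inner normal of the closed half-space `H`, that is,
`H = {x | c ≤ ⟪ν, x⟫}` for some real `c`. -/
def IsInnerUnitNormal {n : ℕ} (H : Set (EuclideanSpace ℝ (Fin n)))
    (ν : EuclideanSpace ℝ (Fin n)) : Prop :=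
  ‖ν‖ = 1 ∧ ∃ c : ℝ, H = {x | c ≤ inner ℝ ν x}

/-- Closed half-spaces. A closed half-space is the same thing as a hyperplane (its boundary)
together with an orientation (a choice of one of the two unit normals). -/
def IsClosedHalfSpace {n : ℕ} (H : Set (EuclideanSpace ℝ (Fin n))) : Prop :=
  ∃ ν, IsInnerUnitNormal H ν

/-- `H` is a supporting half-space of `X` at the boundary point `x` of `X`. -/
def IsSupportingHalfSpaceAt {n : ℕ} (X H : Set (EuclideanSpace ℝ (Fin n)))
    (x : EuclideanSpace ℝ (Fin n)) : Prop :=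
  IsClosedHalfSpace H ∧ X ⊆ H ∧ x ∈ frontier X ∧ x ∈ frontier H

/-- A regular point of `X`: a boundary point with a unique supporting half-space. -/
def IsRegularPoint {n : ℕ} (X : Set (EuclideanSpace ℝ (Fin n)))
    (x : EuclideanSpace ℝ (Fin n)) : Prop :=
  x ∈ frontier X ∧ ∃! H, IsSupportingHalfSpaceAt X H x

/-- A regular supporting half-space of `X`: one that is supporting at some regular point.
Its boundary is a regular supporting hyperplane, here oriented by the normal on the side
of `X`. -/
def IsRegularSupportingHalfSpace {n : ℕ} (X H : Set (EuclideanSpace ℝ (Fin n))) : Prop :=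
  ∃ x, IsRegularPoint X x ∧ IsSupportingHalfSpaceAt X H x

/-- The (oriented) dihedral angle of the half-spaces `H` and `K` is `θ`: it is the angle in
`[0, π]` between their inner normals. -/
def HasDihedralAngle {n : ℕ} (H K : Set (EuclideanSpace ℝ (Fin n))) (θ : ℝ) : Prop :=
  ∃ ν μ, IsInnerUnitNormal H ν ∧ IsInnerUnitNormal K μ ∧ InnerProductGeometry.angle ν μ = θ

end Resilient

namespace Resilient

open Metric Set Filter Topology

variable {n : ℕ} {X : Set (EuclideanSpace ℝ (Fin n))}

/-! From (2) to (1): a closed convex body is the intersection of its regular supporting half-spaces,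
and erosion by `r` pushes each of them inward by `r`. When all the normals have the same inner
product `cos θ ≠ 0` with the unit normal `μ` of `K`, translation by `(r / cos θ) • μ` makes all
these pushes at once.

From (1) to (2): pulling back by `σ` repeatedly puts each point outside `X` into arbitrarily large
balls missing `X`. Their limit is a half-space, which gives convexity
(`exists_halfSpace_of_notMem`). Write `σ x = U x + b` with `b = p + (c - U c)` and `p` orthogonal to
the range of `1 - U`. Applying `σ` to a regular half-space and moving it outward by `r` gives
another one (`IsRegularSupportingHalfSpace.of_erosion`). Its offset measured from `c` changes by
`⟪ν, p⟫ - r`, with `⟪ν, p⟫` unchanged. Offsets of half-spaces containing `X` are bounded above, so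
iterating forward and backward forces `⟪ν, p⟫ = r`: all regular normals make one acute angle with
`p`. -/

theorem mem_erosion_iff {r : ℝ} (hr : 0 < r) {z : EuclideanSpace ℝ (Fin n)} :
    z ∈ erosion r X ↔ ball z r ⊆ X := by
  simp only [erosion, Set.mem_sdiff, mem_iUnion, not_exists, mem_ball, mem_compl_iff]
  constructor
  · rintro ⟨-, h⟩ w hw
    by_contra hwX
    exact h w hwX (by rwa [dist_comm])
  · intro h
    refine ⟨h (mem_ball_self hr), fun y hy hzy => hy (h ?_)⟩
    rwa [mem_ball, dist_comm]

theorem isClosed_erosion {r : ℝ} (hr : 0 < r) : IsClosed (erosion r X) := by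
  have : erosion r X = (⋃ y ∈ Xᶜ, ball y r)ᶜ := by
    ext z
    simp only [erosion, Set.mem_sdiff, mem_compl_iff, and_iff_right_iff_imp]
    intro h
    by_contra hz
    exact h (mem_biUnion hz (mem_ball_self hr))
  rw [this, isClosed_compl_iff]
  exact isOpen_biUnion fun _ _ => isOpen_ball

/-! ### Half-spaces -/

theorem le_of_ball_subset {ν z : EuclideanSpace ℝ (Fin n)} {a r : ℝ} (hν : ‖ν‖ = 1) (hr : 0 < r)
    (h : ball z r ⊆ {x | a ≤ inner ℝ ν x}) : a + r ≤ inner ℝ ν z := by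
  refine le_of_forall_pos_lt_add fun ε hε => ?_
  -- The maximum with 0 keeps the test point in the ball when `ε / 2` exceeds `r`.
  set s := max (r - ε / 2) 0 with hs
  have hs0 : 0 ≤ s := le_max_right _ _
  have hsr : s < r := max_lt (by linarith) hr
  have hmem : z - s • ν ∈ ball z r := by
    simp [mem_ball, norm_smul, hν, abs_of_nonneg hs0, hsr]
  have h1 : a ≤ inner ℝ ν (z - s • ν) := h hmem
  rw [inner_sub_right, inner_smul_right, real_inner_self_eq_norm_sq, hν] at h1
  have := le_max_left (r - ε / 2) 0
  linarith

theorem erosion_subset_halfSpace {ν : EuclideanSpace ℝ (Fin n)} {a r : ℝ} (hν : ‖ν‖ = 1)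
    (hr : 0 < r) (h : X ⊆ {x | a ≤ inner ℝ ν x}) :
    erosion r X ⊆ {x | a + r ≤ inner ℝ ν x} := fun _ hz =>
  le_of_ball_subset hν hr (((mem_erosion_iff hr).1 hz).trans h)

theorem mem_frontier_halfSpace_iff {ν : EuclideanSpace ℝ (Fin n)} {a : ℝ} (hν : ‖ν‖ = 1)
    {x : EuclideanSpace ℝ (Fin n)} :
    x ∈ frontier {x | a ≤ inner ℝ ν x} ↔ inner ℝ ν x = a := by
  have hcl : IsClosed {x : EuclideanSpace ℝ (Fin n) | a ≤ inner ℝ ν x} :=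
    isClosed_le continuous_const (by fun_prop)
  have hop : IsOpen {x : EuclideanSpace ℝ (Fin n) | a < inner ℝ ν x} :=
    isOpen_lt continuous_const (by fun_prop)
  rw [hcl.frontier_eq]
  constructor
  · rintro ⟨h1, h2⟩
    refine le_antisymm (not_lt.1 fun h => h2 ?_) h1
    exact interior_maximal (fun y (hy : a < _) => hy.le) hop h
  · intro h
    refine ⟨h.ge, fun hi => ?_⟩
    obtain ⟨ε, hε, hb⟩ := Metric.mem_nhds_iff.1 (mem_interior_iff_mem_nhds.1 hi)
    linarith [le_of_ball_subset hν hε hb]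

theorem eq_of_one_le_inner {ν μ : EuclideanSpace ℝ (Fin n)} (hν : ‖ν‖ = 1) (hμ : ‖μ‖ = 1)
    (h : 1 ≤ inner ℝ ν μ) : ν = μ := by
  have h1 : ‖ν - μ‖ ^ 2 ≤ 0 := by
    rw [norm_sub_sq_real, hν, hμ]; linarith
  have h2 : ‖ν - μ‖ = 0 := by nlinarith [norm_nonneg (ν - μ)]
  exact sub_eq_zero.1 (norm_eq_zero.1 h2)

/-- If the normals differ, moving along `ν - μ` stays in the first half-space, while the
`μ`-coordinate tends to `-∞`. -/
theorem normal_eq_of_halfSpace_subset {ν μ : EuclideanSpace ℝ (Fin n)} {a c : ℝ} (hν : ‖ν‖ = 1)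
    (hμ : ‖μ‖ = 1)
    (h : {x : EuclideanSpace ℝ (Fin n) | a ≤ inner ℝ ν x} ⊆ {x | c ≤ inner ℝ μ x}) : ν = μ := by
  refine eq_of_one_le_inner hν hμ (not_lt.1 fun hlt => ?_)
  set m := inner ℝ ν μ with hm
  have hνν : inner ℝ ν ν = (1 : ℝ) := by rw [real_inner_self_eq_norm_sq, hν]; norm_num
  have hμμ : inner ℝ μ μ = (1 : ℝ) := by rw [real_inner_self_eq_norm_sq, hμ]; norm_num
  have key : ∀ k : ℝ, 0 ≤ k → c ≤ a * m + k * (m - 1) := by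
    intro k hk
    have h1 : a • ν + k • (ν - μ) ∈ {x : EuclideanSpace ℝ (Fin n) | c ≤ inner ℝ μ x} := by
      apply h
      simp only [mem_ofPred_eq, inner_add_right, inner_smul_right, inner_sub_right, hνν, ← hm]
      nlinarith
    simp only [mem_ofPred_eq, inner_add_right, inner_smul_right, inner_sub_right, hμμ,
      real_inner_comm ν μ, ← hm] at h1
    exact h1
  have h2 := key ((|a * m - c| + 1) / (1 - m)) (div_nonneg (by positivity) (by linarith))
  have h3 : (|a * m - c| + 1) / (1 - m) * (m - 1) = -(|a * m - c| + 1) := by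
    have : (1 : ℝ) - m ≠ 0 := by linarith
    field_simp
    ring
  rw [h3] at h2
  linarith [le_abs_self (a * m - c)]

theorem halfSpace_injective {ν μ : EuclideanSpace ℝ (Fin n)} {a c : ℝ} (hν : ‖ν‖ = 1)
    (hμ : ‖μ‖ = 1)
    (h : {x : EuclideanSpace ℝ (Fin n) | a ≤ inner ℝ ν x} = {x | c ≤ inner ℝ μ x}) :
    ν = μ ∧ a = c := by
  obtain rfl := normal_eq_of_halfSpace_subset hν hμ h.subset
  refine ⟨rfl, ?_⟩
  have h1 : inner ℝ ν (a • ν) = a := by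
    rw [inner_smul_right, real_inner_self_eq_norm_sq, hν]; norm_num
  rw [← (mem_frontier_halfSpace_iff (a := a) hν), h, mem_frontier_halfSpace_iff hν] at h1
  rw [← h1, inner_smul_right, real_inner_self_eq_norm_sq, hν]; norm_num

/-! ### Supporting half-spaces at points touched by an inner ball -/

theorem exists_supporting_halfSpace (hconv : Convex ℝ X)
    (hint : (interior X).Nonempty) {x : EuclideanSpace ℝ (Fin n)} (hx : x ∈ frontier X) :
    ∃ ν : EuclideanSpace ℝ (Fin n), ‖ν‖ = 1 ∧ X ⊆ {y | inner ℝ ν x ≤ inner ℝ ν y} := by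
  have hx' : x ∉ interior X := hx.2
  obtain ⟨f, hf⟩ := geometric_hahn_banach_point_open hconv.interior isOpen_interior hx'
  set v := (InnerProductSpace.toDual ℝ (EuclideanSpace ℝ (Fin n))).symm f with hv
  have hvf : ∀ y, inner ℝ v y = f y := fun y => by
    rw [hv, InnerProductSpace.toDual_symm_apply]
  have hv0 : v ≠ 0 := by
    intro h0
    obtain ⟨q, hq⟩ := hint
    have := hf q hq
    rw [← hvf, ← hvf, h0] at this
    simp at this
  have hnorm : 0 < ‖v‖ := norm_pos_iff.2 hv0
  refine ⟨‖v‖⁻¹ • v, by simp [norm_smul, hnorm.ne'], fun y hy => ?_⟩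
  have hy' : y ∈ closure (interior X) := by
    rw [hconv.closure_interior_eq_closure_of_nonempty_interior hint]
    exact subset_closure hy
  have hle : f x ≤ f y := by
    have : closure (interior X) ⊆ {y | f x ≤ f y} :=
      closure_minimal (fun w hw => (hf w hw).le) (isClosed_le continuous_const f.continuous)
    exact this hy'
  simp only [mem_ofPred_eq, real_inner_smul_left, hvf]
  gcongr

/-- This is equality in Cauchy–Schwarz: the centre has height at least `δ = ‖z - x‖` over the
hyperplane. -/
theorem normal_eq_of_ball_touches {ν x z : EuclideanSpace ℝ (Fin n)} {δ : ℝ} (hν : ‖ν‖ = 1)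
    (hδ : 0 < δ) (hdist : dist z x = δ)
    (h : ball z δ ⊆ {y | inner ℝ ν x ≤ inner ℝ ν y}) : ν = δ⁻¹ • (z - x) := by
  have h1 := le_of_ball_subset hν hδ h
  refine eq_of_one_le_inner hν ?_ ?_
  · rw [norm_smul, ← dist_eq_norm, hdist, Real.norm_of_nonneg (by positivity)]
    field_simp
  · rw [inner_smul_right, inner_sub_right]
    calc (1 : ℝ) = δ⁻¹ * δ := by field_simp
      _ ≤ _ := by gcongr; linarith

/-- Hahn–Banach gives a supporting half-space; the touching ball determines its normal. -/
theorem isRegularPoint_of_ball_touches (hconv : Convex ℝ X)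
    {x z : EuclideanSpace ℝ (Fin n)} {δ : ℝ} (hδ : 0 < δ) (hdist : dist z x = δ)
    (hball : ball z δ ⊆ X) (hx : x ∈ frontier X) :
    IsRegularPoint X x ∧ ‖δ⁻¹ • (z - x)‖ = 1 ∧
      IsSupportingHalfSpaceAt X
        {y | inner ℝ (δ⁻¹ • (z - x)) x ≤ inner ℝ (δ⁻¹ • (z - x)) y} x := by
  have hint : (interior X).Nonempty :=
    ⟨z, interior_maximal hball isOpen_ball (mem_ball_self hδ)⟩
  obtain ⟨ν, hν, hsub⟩ := exists_supporting_halfSpace hconv hint hx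
  obtain rfl := normal_eq_of_ball_touches hν hδ hdist (hball.trans hsub)
  have hsup : IsSupportingHalfSpaceAt X
        {y | inner ℝ (δ⁻¹ • (z - x)) x ≤ inner ℝ (δ⁻¹ • (z - x)) y} x :=
    ⟨⟨_, hν, _, rfl⟩, hsub, hx, (mem_frontier_halfSpace_iff hν).2 rfl⟩
  refine ⟨⟨hx, _, hsup, ?_⟩, hν, hsup⟩
  rintro H ⟨⟨μ, hμ, c, rfl⟩, hXH, -, hxH⟩
  rw [mem_frontier_halfSpace_iff hμ] at hxH
  subst hxH
  obtain rfl := normal_eq_of_ball_touches hμ hδ hdist (hball.trans hXH)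
  rfl

theorem exists_touching_point (hne : Xᶜ.Nonempty)
    {z : EuclideanSpace ℝ (Fin n)} (hpos : 0 < infDist z Xᶜ) :
    ball z (infDist z Xᶜ) ⊆ X ∧ ∃ x ∈ frontier X, dist z x = infDist z Xᶜ := by
  have hball : ball z (infDist z Xᶜ) ⊆ X := by
    have h := disjoint_ball_infDist (x := z) (s := Xᶜ)
    rwa [disjoint_compl_right_iff_subset] at h
  refine ⟨hball, ?_⟩
  obtain ⟨x, hx, hd⟩ := isClosed_closure.exists_infDist_eq_dist hne.closure z
  rw [infDist_closure] at hd
  refine ⟨x, ?_, hd.symm⟩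
  rw [frontier_eq_closure_inter_closure]
  refine ⟨?_, hx⟩
  have : x ∈ closure (ball z (infDist z Xᶜ)) := by
    rw [closure_ball z hpos.ne', mem_closedBall, dist_comm, hd]
  exact closure_mono hball this

/-- A closed convex set with nonempty interior is the intersection of its regular supporting
half-spaces. -/
theorem exists_isRegularSupportingHalfSpace_notMem (hconv : Convex ℝ X) (hcl : IsClosed X)
    (hint : (interior X).Nonempty) {y : EuclideanSpace ℝ (Fin n)} (hy : y ∉ X) :
    ∃ H, IsRegularSupportingHalfSpace X H ∧ X ⊆ H ∧ y ∉ H := by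
  obtain ⟨p, hp⟩ := hint
  obtain ⟨ε, hε, hpε⟩ := Metric.mem_nhds_iff.1 (mem_interior_iff_mem_nhds.1 hp)
  obtain ⟨η, hη, hyη⟩ := Metric.isOpen_iff.1 hcl.isOpen_compl y hy
  have hne : Xᶜ.Nonempty := ⟨y, hy⟩
  have hpX : p ∈ X := interior_subset hp
  have hpy : η ≤ dist p y := by
    by_contra! h
    exact hyη h hpX
  have hD : 0 < dist p y := hη.trans_le hpy
  let g : ℝ → EuclideanSpace ℝ (Fin n) := AffineMap.lineMap p y
  have hφc : Continuous fun t => infDist (g t) Xᶜ :=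
    (continuous_infDist_pt _).comp AffineMap.lineMap_continuous
  have hφ0 : ε ≤ infDist (g 0) Xᶜ := by
    simp only [g, AffineMap.lineMap_apply_zero]
    rw [le_infDist hne]
    intro w hw
    by_contra! h
    exact hw (hpε (by rwa [mem_ball, dist_comm]))
  have hφ1 : infDist (g 1) Xᶜ = 0 := by
    simp only [g, AffineMap.lineMap_apply_one]
    exact infDist_zero_of_mem hy
  -- If `y` were in the half-space found below, then `g t` would have height at least `(1 - t) * ε ≥
  -- ε * η / dist p y = 2 * δ` over its boundary, whereas that height is exactly `δ`.
  set δ := ε * η / (2 * dist p y) with hδdef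
  have hδ : 0 < δ := by positivity
  have hδε : δ ≤ ε := by
    rw [hδdef, div_le_iff₀ (by positivity)]
    nlinarith
  obtain ⟨t, ht, htδ⟩ := intermediate_value_Icc' zero_le_one hφc.continuousOn
    (show δ ∈ Icc _ _ from ⟨hφ1.trans_le hδ.le, hδε.trans hφ0⟩)
  simp only at htδ
  have hgt : g t ∈ X := by
    by_contra h
    rw [infDist_zero_of_mem h] at htδ
    exact hδ.ne htδ
  have h1t : η ≤ (1 - t) * dist p y := by
    have : dist (g t) y = (1 - t) * dist p y := by
      simp only [g, dist_lineMap_right, Real.norm_of_nonneg (sub_nonneg.2 ht.2)]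
    rw [← this]
    by_contra! h
    exact hyη h hgt
  obtain ⟨hball, x, hx, hdist⟩ := exists_touching_point hne (z := g t) (htδ ▸ hδ)
  rw [htδ] at hball hdist
  obtain ⟨hreg, hν, hsup⟩ := isRegularPoint_of_ball_touches hconv hδ hdist hball hx
  refine ⟨_, ⟨x, hreg, hsup⟩, hsup.2.1, fun hyH => ?_⟩
  have hX := hsup.2.1
  have hz : inner ℝ (δ⁻¹ • (g t - x)) (g t) = inner ℝ (δ⁻¹ • (g t - x)) x + δ := by
    have h : inner ℝ (δ⁻¹ • (g t - x)) (g t - x) = δ := by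
      rw [real_inner_smul_left, real_inner_self_eq_norm_sq, ← dist_eq_norm, hdist]
      field_simp
    rw [inner_sub_right] at h
    linarith
  set ν := δ⁻¹ • (g t - x) with hνdef
  have hp' := le_of_ball_subset hν hε (hpε.trans hX)
  have hy' : inner ℝ ν x ≤ inner ℝ ν y := hyH
  have hgeq : inner ℝ ν (g t) = (1 - t) * inner ℝ ν p + t * inner ℝ ν y := by
    have : g t = (1 - t) • p + t • y := by
      simp only [g, AffineMap.lineMap_apply_module]
    rw [this, inner_add_right, inner_smul_right, inner_smul_right]
  have h1 : (1 - t) * ε ≤ δ := by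
    nlinarith [mul_le_mul_of_nonneg_left hp' (sub_nonneg.2 ht.2),
      mul_le_mul_of_nonneg_left hy' ht.1]
  have h2 : ε * η ≤ δ * dist p y := by
    nlinarith [mul_le_mul_of_nonneg_left h1t hε.le, mul_le_mul_of_nonneg_right h1 hD.le]
  have h3 : δ * dist p y = ε * η / 2 := by
    rw [hδdef]; field_simp
  nlinarith [mul_pos hε hη]

/-! ### A common dihedral angle makes every erosion a translate -/

theorem exists_isometryEquiv_erosion_eq (hconv : Convex ℝ X) (hcl : IsClosed X)
    (hint : (interior X).Nonempty) {K : Set (EuclideanSpace ℝ (Fin n))}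
    (hK : IsClosedHalfSpace K) {θ : ℝ} (hθ : θ ≠ Real.pi / 2)
    (hdih : ∀ H, IsRegularSupportingHalfSpace X H → HasDihedralAngle H K θ) {r : ℝ}
    (hr : 0 < r) :
    ∃ σ : EuclideanSpace ℝ (Fin n) ≃ᵢ EuclideanSpace ℝ (Fin n), erosion r X = σ '' X := by
  obtain ⟨μ, hμ, c, rfl⟩ := hK
  set v := (r / Real.cos θ) • μ with hv
  have hsep : ∀ y ∉ X, ∃ (ν : EuclideanSpace ℝ (Fin n)) (a : ℝ), ‖ν‖ = 1 ∧
      X ⊆ {x | a ≤ inner ℝ ν x} ∧ inner ℝ ν y < a ∧ inner ℝ ν v = r := by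
    intro y hy
    obtain ⟨H, hreg, hXH, hyH⟩ := exists_isRegularSupportingHalfSpace_notMem hconv hcl hint hy
    obtain ⟨ν, μ', ⟨hν, a, rfl⟩, ⟨hμ', c', hc'⟩, hang⟩ := hdih H hreg
    obtain ⟨rfl, -⟩ := halfSpace_injective hμ hμ' hc'
    refine ⟨ν, a, hν, hXH, not_le.1 hyH, ?_⟩
    have hcos : Real.cos θ = inner ℝ ν μ := by
      rw [← hang, InnerProductGeometry.cos_angle, hν, hμ]; simp
    have hcos0 : Real.cos θ ≠ 0 := by
      rw [hcos, Ne, InnerProductGeometry.inner_eq_zero_iff_angle_eq_pi_div_two, hang]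
      exact hθ
    rw [hv, inner_smul_right, ← hcos]
    field_simp
  refine ⟨IsometryEquiv.addRight v, ?_⟩
  ext z
  rw [mem_erosion_iff hr]
  constructor
  · intro hz
    refine ⟨z - v, ?_, by simp⟩
    by_contra hzv
    obtain ⟨ν, a, hν, hX, hlt, hνv⟩ := hsep _ hzv
    have := le_of_ball_subset hν hr (hz.trans hX)
    rw [inner_sub_right] at hlt
    linarith
  · rintro ⟨x, hx, rfl⟩ w hw
    by_contra hwX
    obtain ⟨ν, a, hν, hX, hlt, hνv⟩ := hsep _ hwX
    have h1 : a ≤ inner ℝ ν x := hX hx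
    have h2 : inner ℝ ν (x + v - w) ≤ ‖x + v - w‖ := by
      simpa [hν] using real_inner_le_norm ν (x + v - w)
    have h3 : ‖x + v - w‖ < r := by
      rw [← dist_eq_norm, dist_comm]; exact hw
    rw [inner_sub_right, inner_add_right] at h2
    linarith

/-! ### Sets isometric to an erosion are convex -/

section Isometric

variable {r : ℝ} {σ : EuclideanSpace ℝ (Fin n) ≃ᵢ EuclideanSpace ℝ (Fin n)}

theorem isClosed_of_erosion_eq (hr : 0 < r) (hσ : erosion r X = σ '' X) : IsClosed X := by
  have h : IsClosed (σ '' X) := hσ ▸ isClosed_erosion hr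
  exact σ.toHomeomorph.isClosed_image.1 h

theorem interior_nonempty_of_erosion_eq (hr : 0 < r) (hσ : erosion r X = σ '' X)
    (hX : X.Nonempty) : (interior X).Nonempty := by
  obtain ⟨x, hx⟩ := hX
  have : σ x ∈ erosion r X := hσ ▸ mem_image_of_mem σ hx
  exact ⟨σ x, interior_maximal ((mem_erosion_iff hr).1 this) isOpen_ball (mem_ball_self hr)⟩

/-- A point is outside `X` exactly when its `σ`-image is within `r` of the complement. Each pullback
therefore enlarges an empty ball's radius by `r`, and the centre recedes by less than `r`. -/
theorem exists_large_ball_subset_compl (hr : 0 < r) (hσ : erosion r X = σ '' X) (k : ℕ) :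
    ∀ x ∉ X, ∃ c, dist x c < (k + 1) * r ∧ ball c ((k + 1) * r) ⊆ Xᶜ := by
  have hstep : ∀ {y w}, y ∉ X → dist (σ w) y < r → w ∉ X := by
    intro y w hy hw hwX
    have : σ w ∈ erosion r X := hσ ▸ mem_image_of_mem σ hwX
    exact hy ((mem_erosion_iff hr).1 this (by rwa [mem_ball, dist_comm]))
  have hout : ∀ x ∉ X, ∃ y ∉ X, dist (σ x) y < r := by
    intro x hx
    have : σ x ∉ erosion r X := by
      rw [hσ, σ.injective.mem_set_image]; exact hx
    rw [mem_erosion_iff hr, not_subset] at this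
    obtain ⟨y, hy, hyX⟩ := this
    exact ⟨y, hyX, by rwa [dist_comm]⟩
  induction k with
  | zero =>
    intro x hx
    obtain ⟨y, hy, hd⟩ := hout x hx
    refine ⟨σ.symm y, ?_, fun w hw => hstep hy ?_⟩
    · rw [← σ.dist_eq, σ.apply_symm_apply]; simpa using hd
    · rw [mem_ball, ← σ.dist_eq, σ.apply_symm_apply] at hw; simpa using hw
  | succ k ih =>
    intro x hx
    obtain ⟨y, hy, hd⟩ := hout x hx
    obtain ⟨c, hc, hcX⟩ := ih y hy
    have hk : (0 : ℝ) < (k + 1) * r := by positivity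
    push_cast
    refine ⟨σ.symm c, ?_, fun w hw => ?_⟩
    · rw [← σ.dist_eq, σ.apply_symm_apply]
      linarith [dist_triangle (σ x) y c]
    · rw [mem_ball, ← σ.dist_eq, σ.apply_symm_apply] at hw
      have hw' : σ w ∈ Metric.thickening r (ball c ((k + 1) * r)) := by
        rw [thickening_ball hr hk, mem_ball]
        linarith
      obtain ⟨y', hy', hd'⟩ := mem_thickening_iff.1 hw'
      exact hstep (hcX hy') hd'

/-- Rescale about `x` so that the empty balls have radius 1. Their centres then lie in the closed
unit ball and subconverge to `u`, while each fixed point of `X` shrinks to the origin. -/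
theorem exists_halfSpace_of_notMem (hr : 0 < r) (hσ : erosion r X = σ '' X) (hX : X.Nonempty)
    {x : EuclideanSpace ℝ (Fin n)} (hx : x ∉ X) :
    ∃ u : EuclideanSpace ℝ (Fin n), ‖u‖ = 1 ∧ ∀ p ∈ X, inner ℝ u p ≤ inner ℝ u x := by
  choose c hc hcX using fun k => exists_large_ball_subset_compl hr hσ k x hx
  let s : ℕ → ℝ := fun k => ((k + 1) * r)⁻¹
  have hs : ∀ k, 0 < s k := fun k => by positivity
  have hslim : Tendsto s atTop (𝓝 0) := by
    have h := (tendsto_one_div_add_atTop_nhds_zero_nat (𝕜 := ℝ)).mul_const r⁻¹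
    rw [zero_mul] at h
    refine h.congr fun k => ?_
    simp only [s, mul_inv, one_div]
  let u : ℕ → EuclideanSpace ℝ (Fin n) := fun k => s k • (c k - x)
  have hu1 : ∀ k, ‖u k‖ ≤ 1 := by
    intro k
    have h := (hc k).le
    rw [dist_comm, dist_eq_norm] at h
    simp only [u, norm_smul, Real.norm_of_nonneg (hs k).le]
    calc s k * ‖c k - x‖ ≤ s k * ((k + 1) * r) := by have := hs k; gcongr
      _ = 1 := inv_mul_cancel₀ (by positivity)
  have hfar : ∀ k, ∀ p ∈ X, 1 ≤ ‖s k • (p - x) - u k‖ := by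
    intro k p hp
    have h : (k + 1) * r ≤ ‖p - c k‖ := by
      by_contra! h
      exact hcX k (by rwa [mem_ball, dist_eq_norm]) hp
    have he : s k • (p - x) - u k = s k • (p - c k) := by
      simp only [u, ← smul_sub]; congr 1; abel
    rw [he, norm_smul, Real.norm_of_nonneg (hs k).le]
    calc (1 : ℝ) = s k * ((k + 1) * r) := (inv_mul_cancel₀ (by positivity)).symm
      _ ≤ _ := by have := hs k; gcongr
  obtain ⟨u₀, hu₀, φ, hφ, hlim⟩ := (isCompact_closedBall
    (0 : EuclideanSpace ℝ (Fin n)) 1).tendsto_subseq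
    (x := u) (fun k => by simpa using hu1 k)
  have hsφ := hslim.comp hφ.tendsto_atTop
  refine ⟨u₀, le_antisymm (by simpa using hu₀) ?_, fun p hp => ?_⟩
  · obtain ⟨p, hp⟩ := hX
    have ht : Tendsto (fun k => ‖(s ∘ φ) k • (p - x) - (u ∘ φ) k‖) atTop
        (𝓝 ‖(0 : ℝ) • (p - x) - u₀‖) := ((hsφ.smul_const (p - x)).sub hlim).norm
    simpa using ge_of_tendsto' ht fun k => hfar (φ k) p hp
  -- Expand the square in `hfar`, use `‖u k‖ ≤ 1`, and divide by `s k`.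
  · have hineq : ∀ k, 2 * inner ℝ (u k) (p - x) ≤ s k * ‖p - x‖ ^ 2 := by
      intro k
      have h1 := hfar k p hp
      have h2 : 1 ≤ ‖s k • (p - x) - u k‖ ^ 2 := by nlinarith
      rw [norm_sub_sq_real, norm_smul, Real.norm_of_nonneg (hs k).le, real_inner_smul_left,
        real_inner_comm] at h2
      have h3 : ‖u k‖ ^ 2 ≤ 1 := by nlinarith [hu1 k, norm_nonneg (u k)]
      have h4 : s k * (2 * inner ℝ (u k) (p - x)) ≤ s k * (s k * ‖p - x‖ ^ 2) := by nlinarith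
      exact le_of_mul_le_mul_left h4 (hs k)
    have ht1 : Tendsto (fun k => 2 * inner ℝ ((u ∘ φ) k) (p - x)) atTop
        (𝓝 (2 * inner ℝ u₀ (p - x))) := (hlim.inner tendsto_const_nhds).const_mul 2
    have ht2 := hsφ.mul_const (‖p - x‖ ^ 2)
    have h := le_of_tendsto_of_tendsto' ht1 ht2 fun k => hineq (φ k)
    rw [inner_sub_right] at h
    linarith

/-- A point outside `X` lies on the boundary of a half-space containing `X`, so it cannot be
interior to the convex hull; closedness of `X` then absorbs the rest of the hull. -/
theorem convex_of_erosion_eq (hr : 0 < r) (hσ : erosion r X = σ '' X) (hX : X.Nonempty) :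
    Convex ℝ X := by
  have hcl := isClosed_of_erosion_eq hr hσ
  have hint := interior_nonempty_of_erosion_eq hr hσ hX
  have hsub : interior (convexHull ℝ X) ⊆ X := by
    intro x hx
    by_contra hxX
    obtain ⟨u, hu, hle⟩ := exists_halfSpace_of_notMem hr hσ hX hxX
    have hhull : convexHull ℝ X ⊆ {p | -inner ℝ u x ≤ inner ℝ (-u) p} := by
      refine convexHull_min (fun p hp => ?_) ?_
      · simpa using hle p hp
      · exact convex_halfSpace_ge (innerSL ℝ (-u)).isLinear _
    obtain ⟨ε, hε, hb⟩ := Metric.mem_nhds_iff.1 (mem_interior_iff_mem_nhds.1 hx)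
    have := le_of_ball_subset (by rwa [norm_neg]) hε (hb.trans hhull)
    rw [inner_neg_left] at this
    linarith
  have hconv := convex_convexHull ℝ X
  have hhull : convexHull ℝ X ⊆ X := by
    calc convexHull ℝ X ⊆ closure (convexHull ℝ X) := subset_closure
      _ = closure (interior (convexHull ℝ X)) :=
        (hconv.closure_interior_eq_closure_of_nonempty_interior
          (hint.mono (interior_mono (subset_convexHull ℝ X)))).symm
      _ ⊆ X := closure_minimal hsub hcl
  rw [← (subset_convexHull ℝ X).antisymm hhull] at hconv
  exact hconv

end Isometric

/-! ### Regular supporting half-spaces of erosions and of isometric images -/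

theorem IsRegularSupportingHalfSpace.subset {H : Set (EuclideanSpace ℝ (Fin n))}
    (h : IsRegularSupportingHalfSpace X H) : X ⊆ H := by
  obtain ⟨x, -, -, h, -⟩ := h
  exact h

/-- The `r`-ball about a regular point `q` of the erosion touches the boundary of `X` at a regular
point. The half-space there, pushed inward by `r`, supports the erosion at `q`, hence is the given
one by uniqueness. -/
theorem IsRegularSupportingHalfSpace.of_erosion (hconv : Convex ℝ X) {r : ℝ}
    (hr : 0 < r) {ν : EuclideanSpace ℝ (Fin n)} {a : ℝ} (hν : ‖ν‖ = 1)
    (h : IsRegularSupportingHalfSpace (erosion r X) {x | a ≤ inner ℝ ν x}) :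
    IsRegularSupportingHalfSpace X {x | a - r ≤ inner ℝ ν x} := by
  obtain ⟨q, ⟨hq, huniq⟩, hsup⟩ := h
  have hqe : q ∈ erosion r X := (isClosed_erosion hr).frontier_subset hq
  have hqint : q ∉ interior (erosion r X) := hq.2
  have hqball := (mem_erosion_iff hr).1 hqe
  have hne : Xᶜ.Nonempty := by
    rw [nonempty_compl]
    rintro rfl
    apply hqint
    have : erosion r (univ : Set (EuclideanSpace ℝ (Fin n))) = univ := by
      ext z; simp [mem_erosion_iff hr]
    simp [this]
  have hge : r ≤ infDist q Xᶜ := by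
    rw [le_infDist hne]
    intro w hw
    by_contra! h
    exact hw (hqball (by rwa [mem_ball, dist_comm]))
  have hle : infDist q Xᶜ ≤ r := by
    by_contra! hlt
    apply hqint
    refine interior_maximal (t := ball q (infDist q Xᶜ - r)) ?_ isOpen_ball
      (mem_ball_self (sub_pos.2 hlt))
    intro z hz
    rw [mem_erosion_iff hr]
    refine Subset.trans (ball_subset_ball' ?_) (exists_touching_point hne (hr.trans hlt)).1
    rw [mem_ball] at hz
    linarith
  have heq : infDist q Xᶜ = r := le_antisymm hle hge
  obtain ⟨-, y, hy, hdist⟩ := exists_touching_point hne (z := q) (heq ▸ hr)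
  rw [heq] at hdist
  obtain ⟨hreg, hν', hsup'⟩ := isRegularPoint_of_ball_touches hconv hr hdist hqball hy
  have hz : inner ℝ (r⁻¹ • (q - y)) q = inner ℝ (r⁻¹ • (q - y)) y + r := by
    have h : inner ℝ (r⁻¹ • (q - y)) (q - y) = r := by
      rw [real_inner_smul_left, real_inner_self_eq_norm_sq, ← dist_eq_norm, hdist]
      field_simp
    rw [inner_sub_right] at h
    linarith
  have hsup2 : IsSupportingHalfSpaceAt (erosion r X)
      {x | inner ℝ (r⁻¹ • (q - y)) y + r ≤ inner ℝ (r⁻¹ • (q - y)) x} q :=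
    ⟨⟨_, hν', _, rfl⟩, erosion_subset_halfSpace hν' hr hsup'.2.1, hq,
      (mem_frontier_halfSpace_iff hν').2 hz⟩
  obtain ⟨h1, h2⟩ := halfSpace_injective hν hν' (huniq.unique hsup hsup2)
  rw [h2, add_sub_cancel_right, h1]
  exact ⟨y, hreg, hsup'⟩

theorem image_halfSpace (U : EuclideanSpace ℝ (Fin n) ≃ₗᵢ[ℝ] EuclideanSpace ℝ (Fin n))
    {σ : EuclideanSpace ℝ (Fin n) ≃ᵢ EuclideanSpace ℝ (Fin n)} {b : EuclideanSpace ℝ (Fin n)}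
    (hσ : ∀ x, σ x = U x + b) (ν : EuclideanSpace ℝ (Fin n)) (a : ℝ) :
    σ '' {x | a ≤ inner ℝ ν x} = {x | a + inner ℝ (U ν) b ≤ inner ℝ (U ν) x} := by
  ext z
  obtain ⟨x, rfl⟩ := σ.surjective z
  rw [σ.injective.mem_set_image, mem_ofPred_eq, mem_ofPred_eq, hσ, inner_add_right,
    U.inner_map_map, add_le_add_iff_right]

theorem IsClosedHalfSpace.image
    (U : EuclideanSpace ℝ (Fin n) ≃ₗᵢ[ℝ] EuclideanSpace ℝ (Fin n))
    {σ : EuclideanSpace ℝ (Fin n) ≃ᵢ EuclideanSpace ℝ (Fin n)} {b : EuclideanSpace ℝ (Fin n)}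
    (hσ : ∀ x, σ x = U x + b) {H : Set (EuclideanSpace ℝ (Fin n))} (hH : IsClosedHalfSpace H) :
    IsClosedHalfSpace (σ '' H) := by
  obtain ⟨ν, hν, a, rfl⟩ := hH
  exact ⟨U ν, by rwa [U.norm_map], _, image_halfSpace U hσ ν a⟩

theorem isSupportingHalfSpaceAt_image_iff
    (U : EuclideanSpace ℝ (Fin n) ≃ₗᵢ[ℝ] EuclideanSpace ℝ (Fin n))
    {σ : EuclideanSpace ℝ (Fin n) ≃ᵢ EuclideanSpace ℝ (Fin n)} {b : EuclideanSpace ℝ (Fin n)}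
    (hσ : ∀ x, σ x = U x + b) {H : Set (EuclideanSpace ℝ (Fin n))}
    {x : EuclideanSpace ℝ (Fin n)} :
    IsSupportingHalfSpaceAt (σ '' X) (σ '' H) (σ x) ↔ IsSupportingHalfSpaceAt X H x := by
  have hfr : ∀ Y : Set (EuclideanSpace ℝ (Fin n)), σ x ∈ frontier (σ '' Y) ↔ x ∈ frontier Y := by
    intro Y
    have h : σ '' frontier Y = frontier (σ '' Y) := σ.toHomeomorph.image_frontier Y
    rw [← h, σ.injective.mem_set_image]
  have hsymm : ∀ x, σ.symm x = U.symm x + -U.symm b := by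
    intro x
    rw [σ.symm_apply_eq, hσ]
    simp
  have hhs : IsClosedHalfSpace (σ '' H) ↔ IsClosedHalfSpace H := by
    refine ⟨fun h => ?_, fun h => h.image U hσ⟩
    have := h.image U.symm hsymm
    rwa [← image_comp, IsometryEquiv.symm_comp_self, image_id] at this
  rw [IsSupportingHalfSpaceAt, IsSupportingHalfSpaceAt, hfr, hfr, hhs,
    image_subset_image_iff σ.injective]

theorem IsRegularSupportingHalfSpace.image
    (U : EuclideanSpace ℝ (Fin n) ≃ₗᵢ[ℝ] EuclideanSpace ℝ (Fin n))
    {σ : EuclideanSpace ℝ (Fin n) ≃ᵢ EuclideanSpace ℝ (Fin n)} {b : EuclideanSpace ℝ (Fin n)}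
    (hσ : ∀ x, σ x = U x + b) {H : Set (EuclideanSpace ℝ (Fin n))}
    (h : IsRegularSupportingHalfSpace X H) :
    IsRegularSupportingHalfSpace (σ '' X) (σ '' H) := by
  obtain ⟨x, ⟨-, huniq⟩, hsup⟩ := h
  have hsup' := (isSupportingHalfSpaceAt_image_iff U hσ).2 hsup
  refine ⟨σ x, ⟨hsup'.2.2.1, _, hsup', fun H' hH' => ?_⟩, hsup'⟩
  have hH'eq : σ '' (σ ⁻¹' H') = H' := image_preimage_eq H' σ.surjective
  rw [← hH'eq] at hH' ⊢
  rw [huniq.unique ((isSupportingHalfSpaceAt_image_iff U hσ).1 hH') hsup]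

/-! ### The axis of the isometry makes a common angle with all regular normals -/

/-- Geometrically, `x ↦ U x + b` sends `c` to `c + p`: this is the decomposition of a screw motion,
with `p` along its axis. -/
theorem exists_inner_invariant_decomposition
    (U : EuclideanSpace ℝ (Fin n) ≃ₗᵢ[ℝ] EuclideanSpace ℝ (Fin n))
    (b : EuclideanSpace ℝ (Fin n)) :
    ∃ p c : EuclideanSpace ℝ (Fin n), b = p + (c - U c) ∧
      ∀ x, inner ℝ (U x) p = inner ℝ x p := by
  let A : EuclideanSpace ℝ (Fin n) →ₗ[ℝ] EuclideanSpace ℝ (Fin n) :=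
    LinearMap.id - U.toLinearEquiv.toLinearMap
  obtain ⟨y, ⟨c, rfl⟩, p, hp, hb⟩ := (LinearMap.range A).exists_add_mem_mem_orthogonal b
  refine ⟨p, c, by rw [hb, add_comm]; rfl, fun x => ?_⟩
  have h := (Submodule.mem_orthogonal _ _).1 hp (A x) ⟨x, rfl⟩
  have hA : A x = x - U x := rfl
  rw [hA, inner_sub_left] at h
  linarith

theorem nonpos_of_forall_nat_mul_le {β M : ℝ} (h : ∀ k : ℕ, k * β ≤ M) : β ≤ 0 := by
  by_contra! hβ
  obtain ⟨k, hk⟩ := exists_nat_gt (M / β)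
  rw [div_lt_iff₀ hβ] at hk
  linarith [h k]

theorem exists_forall_inner_normal_eq {r : ℝ}
    {σ : EuclideanSpace ℝ (Fin n) ≃ᵢ EuclideanSpace ℝ (Fin n)} (hr : 0 < r)
    (hσ : erosion r X = σ '' X) (hX : X.Nonempty) :
    ∃ p : EuclideanSpace ℝ (Fin n), ∀ (ν : EuclideanSpace ℝ (Fin n)) (a : ℝ), ‖ν‖ = 1 →
      IsRegularSupportingHalfSpace X {x | a ≤ inner ℝ ν x} → inner ℝ ν p = r := by
  have hconv := convex_of_erosion_eq hr hσ hX
  let U := σ.toRealLinearIsometryEquiv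
  set b := σ 0 with hb
  have hU : ∀ x, σ x = U x + b := fun x => by
    simp [U, hb]
  obtain ⟨p, c, hbpc, hp⟩ := exists_inner_invariant_decomposition U b
  have hUb : ∀ ν, inner ℝ (U ν) b = inner ℝ ν p + inner ℝ (U ν) c - inner ℝ ν c := by
    intro ν
    rw [hbpc, inner_add_right, inner_sub_right, hp, U.inner_map_map]
    ring
  obtain ⟨x₀, hx₀⟩ := hX
  have hbound : ∀ (ν : EuclideanSpace ℝ (Fin n)) (a : ℝ), ‖ν‖ = 1 →
      X ⊆ {x | a ≤ inner ℝ ν x} → a - inner ℝ ν c ≤ ‖x₀ - c‖ := by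
    intro ν a hν hsub
    have h1 : a ≤ inner ℝ ν x₀ := hsub hx₀
    have h2 := real_inner_le_norm ν (x₀ - c)
    rw [hν, one_mul, inner_sub_right] at h2
    linarith
  refine ⟨p, fun ν a hν hreg => ?_⟩
  have hforward : ∀ k : ℕ, ∃ (ν' : EuclideanSpace ℝ (Fin n)) (a' : ℝ), ‖ν'‖ = 1 ∧
      IsRegularSupportingHalfSpace X {x | a' ≤ inner ℝ ν' x} ∧ inner ℝ ν' p = inner ℝ ν p ∧
      a' - inner ℝ ν' c = a - inner ℝ ν c + k * (inner ℝ ν p - r) := by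
    intro k
    induction k with
    | zero => exact ⟨ν, a, hν, hreg, rfl, by simp⟩
    | succ k ih =>
      obtain ⟨ν', a', hν', hreg', hp', ha'⟩ := ih
      have h := hreg'.image U hU
      rw [← hσ, image_halfSpace U hU] at h
      have hUν : ‖U ν'‖ = 1 := by rwa [U.norm_map]
      refine ⟨U ν', _, hUν, h.of_erosion hconv hr hUν, by rw [hp, hp'], ?_⟩
      rw [hUb, hp']
      push_cast
      linarith
  -- Pulling back needs only containment, not regularity: push the half-space inward by `r` and
  -- apply the inverse of `σ`.
  have hbackward : ∀ k : ℕ, ∃ (ν' : EuclideanSpace ℝ (Fin n)) (a' : ℝ), ‖ν'‖ = 1 ∧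
      X ⊆ {x | a' ≤ inner ℝ ν' x} ∧ inner ℝ ν' p = inner ℝ ν p ∧
      a' - inner ℝ ν' c = a - inner ℝ ν c + k * (r - inner ℝ ν p) := by
    intro k
    induction k with
    | zero => exact ⟨ν, a, hν, hreg.subset, rfl, by simp⟩
    | succ k ih =>
      obtain ⟨ν', a', hν', hsub', hp', ha'⟩ := ih
      obtain ⟨μ, rfl⟩ := U.surjective ν'
      rw [hp] at hp'
      refine ⟨μ, a' + r - inner ℝ (U μ) b, by rwa [U.norm_map] at hν', fun x hx => ?_, hp', ?_⟩
      · have h := erosion_subset_halfSpace hν' hr hsub' (hσ ▸ mem_image_of_mem σ hx)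
        rw [mem_ofPred_eq, hU, inner_add_right, U.inner_map_map] at h
        rw [mem_ofPred_eq]
        linarith
      · rw [hUb, hp']
        push_cast
        linarith
  have h1 : inner ℝ ν p - r ≤ 0 := by
    refine nonpos_of_forall_nat_mul_le (M := ‖x₀ - c‖ - (a - inner ℝ ν c)) fun k => ?_
    obtain ⟨ν', a', hν', hreg', -, ha'⟩ := hforward k
    linarith [hbound ν' a' hν' hreg'.subset]
  have h2 : r - inner ℝ ν p ≤ 0 := by
    refine nonpos_of_forall_nat_mul_le (M := ‖x₀ - c‖ - (a - inner ℝ ν c)) fun k => ?_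
    obtain ⟨ν', a', hν', hsub', -, ha'⟩ := hbackward k
    linarith [hbound ν' a' hν' hsub']
  linarith

theorem exists_common_dihedralAngle (hn : 1 ≤ n) {r : ℝ}
    {σ : EuclideanSpace ℝ (Fin n) ≃ᵢ EuclideanSpace ℝ (Fin n)} (hr : 0 < r)
    (hσ : erosion r X = σ '' X) (hX : X.Nonempty) :
    ∃ K : Set (EuclideanSpace ℝ (Fin n)), IsClosedHalfSpace K ∧
      ∃ θ : ℝ, θ ≠ Real.pi / 2 ∧
        ∀ H, IsRegularSupportingHalfSpace X H → HasDihedralAngle H K θ := by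
  obtain ⟨p, hp⟩ := exists_forall_inner_normal_eq hr hσ hX
  rcases eq_or_ne p 0 with rfl | hp0
  -- With `p = 0` there are no regular half-spaces, so any `K` will do; `1 ≤ n` supplies a unit
  -- vector.
  · let e : EuclideanSpace ℝ (Fin n) := EuclideanSpace.single ⟨0, hn⟩ 1
    refine ⟨{x | 0 ≤ inner ℝ e x}, ⟨e, by simp [e], 0, rfl⟩, 0, by positivity, fun H hH => ?_⟩
    obtain ⟨ν, hν, a, rfl⟩ := hH.choose_spec.2.1
    have := hp ν a hν hH
    rw [inner_zero_right] at this
    exact absurd this hr.ne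
  · have hpos : 0 < ‖p‖ := norm_pos_iff.2 hp0
    have hμ : ‖‖p‖⁻¹ • p‖ = 1 := by simp [norm_smul, hpos.ne']
    refine ⟨{x | 0 ≤ inner ℝ (‖p‖⁻¹ • p) x}, ⟨_, hμ, 0, rfl⟩, Real.arccos (‖p‖⁻¹ * r), ?_,
      fun H hH => ?_⟩
    · rw [Ne, Real.arccos_eq_pi_div_two]
      positivity
    · obtain ⟨ν, hν, a, rfl⟩ := hH.choose_spec.2.1
      refine ⟨ν, ‖p‖⁻¹ • p, ⟨hν, a, rfl⟩, ⟨hμ, 0, rfl⟩, ?_⟩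
      rw [InnerProductGeometry.angle, hν, hμ, inner_smul_right, hp ν a hν hH]
      simp

end Resilient

theorem mainTheorem5 (n : ℕ) (hn : 1 ≤ n) (X : Set (EuclideanSpace ℝ (Fin n)))
    (hX : X.Nonempty) :
    (∃ r : ℝ, 0 < r ∧
      ∃ σ : EuclideanSpace ℝ (Fin n) ≃ᵢ EuclideanSpace ℝ (Fin n),
        Resilient.erosion r X = σ '' X) ↔
    (IsClosed X ∧ Convex ℝ X ∧ (interior X).Nonempty ∧
      ∃ K : Set (EuclideanSpace ℝ (Fin n)), Resilient.IsClosedHalfSpace K ∧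
        ∃ θ : ℝ, θ ≠ Real.pi / 2 ∧
          ∀ H : Set (EuclideanSpace ℝ (Fin n)),
            Resilient.IsRegularSupportingHalfSpace X H → Resilient.HasDihedralAngle H K θ) := by
  constructor
  · rintro ⟨r, hr, σ, hσ⟩
    exact ⟨Resilient.isClosed_of_erosion_eq hr hσ, Resilient.convex_of_erosion_eq hr hσ hX,
      Resilient.interior_nonempty_of_erosion_eq hr hσ hX,
      Resilient.exists_common_dihedralAngle hn hr hσ hX⟩
  · rintro ⟨hcl, hconv, hint, K, hK, θ, hθ, hdih⟩
    exact ⟨1, one_pos,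
      Resilient.exists_isometryEquiv_erosion_eq hconv hcl hint hK hθ hdih one_pos⟩
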